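/- Let $G$ be a Polish group, i.e. a topological group whose topology is separable and completely metrizable, and let $X$ be a Polish $G$-space, i.e. a Polish (separable, completely metrizable) topological space with topology $\tau$, together with an action $G\times X\to X$, $(g,x)\mapsto g\cdot x$, that is continuous on the product. Let $B\subseteq X$ be a Borel set that is invariant, i.e. $g\cdot x\in B$ for all $g\in G$ and $x\in B$. Then there is a Polish topology $\tau'$ on $X$, finer than $\tau$ and having the same Borel sets as $\tau$, such that $B$ is clopen in $\tau'$ and the action $G\times X\to X$ is still continuous when $X$ carries $\tau'$ (and $G$ its original topology). -/

import Mathlib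

open Set Filter Topology TopologicalSpace

/-! Choose a countable basis `𝓤` of `G` and a countable family `𝓑` of Borel sets that contains `B`
and a basis of the original topology, is closed under complements and Vaught transforms, and is
itself a basis of some Polish topology `σ`, for which the action need not be continuous. The new
topology is generated by the sets `vaught U A` with `U ∈ 𝓤`, `A ∈ 𝓑`. Translating a point by `g`
only translates the set `U`, so the action is continuous (`exists_mem_vaught_of_smul`). An invariant
set equals its own transforms, so `B` and `Bᶜ` become open. Regularity rests on the Baire property
of Borel sets. The main point is Polishness. Coding `x` by the set of pairs `(U, A)` with `x ∈
vaught U A` embeds `X` in a power of the Sierpinski space. By `range_code`, the codes are the sets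
of pairs satisfying countably many implications between open conditions: completeness of `G` and of
`(X, σ)` turns such a set of pairs into a limit `(g, y)`, and the coded point is `g⁻¹ • y`. Thus `X`
is a closed subset of a Gδ set in a completion. -/

/-! ### Gδ sets and a criterion for Polishness. -/

/-- A Gδ subset of a Polish space is Polish. -/
theorem IsGδ.polishSpace {Y : Type*} [TopologicalSpace Y] [PolishSpace Y] {s : Set Y}
    (hs : IsGδ s) : PolishSpace s := by
  obtain ⟨U, hU, rfl⟩ := isGδ_iff_eq_iInter_nat.1 hs
  have : ∀ n, PolishSpace (U n) := fun n => (hU n).polishSpace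
  let f : (⋂ n, U n : Set Y) → ∀ n, U n := fun x n => ⟨x, mem_iInter.1 x.2 n⟩
  have hf : Continuous f :=
    continuous_pi fun n => Continuous.subtype_mk continuous_subtype_val _
  have hind : IsInducing f := by
    refine IsInducing.of_comp hf (g := fun y => (y 0 : Y)) ?_ ?_
    · fun_prop
    · exact IsInducing.subtypeVal
  have hrange : range f = ⋂ n, {y : ∀ n, U n | (y n : Y) = y 0} := by
    ext y
    simp only [mem_range, mem_iInter, mem_ofPred_eq]
    constructor
    · rintro ⟨x, rfl⟩ n
      rfl
    · intro h
      refine ⟨⟨y 0, mem_iInter.2 fun n => h n ▸ (y n).2⟩, ?_⟩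
      funext n
      exact Subtype.ext (h n).symm
  refine IsClosedEmbedding.polishSpace (f := f) ⟨⟨hind, fun x y hxy => ?_⟩, ?_⟩
  · exact Subtype.ext (congrArg (fun z : ∀ n, U n => (z 0 : Y)) hxy)
  · rw [hrange]
    exact isClosed_iInter fun n => isClosed_eq (by fun_prop) (by fun_prop)

/-- In a metrizable space, an implication between two open conditions defines a Gδ set. -/
theorem IsOpen.isGδ_imp {Z : Type*} [TopologicalSpace Z] [MetrizableSpace Z] {p q : Z → Prop}
    (hp : IsOpen {z | p z}) (hq : IsOpen {z | q z}) : IsGδ {z | p z → q z} := by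
  let := metrizableSpaceMetric Z
  have : {z | p z → q z} = {z | p z}ᶜ ∪ {z | q z} := by
    ext z
    simp [imp_iff_not_or]
  rw [this]
  exact hp.isClosed_compl.isGδ.union hq.isGδ

universe u in
/-- A regular second countable T₀ space is Polish if it embeds in a power of the Sierpinski space
with a range whose preimages under continuous maps from metrizable spaces are Gδ. -/
theorem PolishSpace.of_isInducing_prop {Y : Type u} {ι : Type*} [TopologicalSpace Y] [T3Space Y]
    [SecondCountableTopology Y] {e : Y → ι → Prop} (he : IsInducing e)
    (hrange : ∀ (Z : Type u) [TopologicalSpace Z] [MetrizableSpace Z] (f : Z → ι → Prop),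
      Continuous f → IsGδ (f ⁻¹' range e)) : PolishSpace Y := by
  let := metrizableSpaceMetric Y
  have hc : IsInducing ((↑) : Y → UniformSpace.Completion Y) :=
    UniformSpace.Completion.isUniformInducing_coe Y |>.isInducing
  have hopen : ∀ i, ∃ W : Set (UniformSpace.Completion Y), IsOpen W ∧
      ((↑) : Y → UniformSpace.Completion Y) ⁻¹' W = {y | e y i} := fun i =>
    hc.isOpen_iff.1 (continuous_Prop.1 ((continuous_apply i).comp he.continuous))
  choose W hWo hW using hopen
  let f : UniformSpace.Completion Y → ι → Prop := fun y i => y ∈ W i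
  have hf : Continuous f := continuous_pi fun i => continuous_Prop.2 (hWo i)
  have hfe : ∀ y : Y, f y = e y := fun y => funext fun i => by
    change ((y : UniformSpace.Completion Y) ∈ W i) = e y i
    exact congrArg (fun s : Set Y => y ∈ s) (hW i)
  have : PolishSpace (UniformSpace.Completion Y) := inferInstance
  have : PolishSpace (f ⁻¹' range e) := (hrange _ f hf).polishSpace
  -- The Gδ set `f ⁻¹' range e` contains the copy of `Y`, and decoding `f z` through `e` retracts it
  -- onto that copy, which is therefore closed in it.
  choose r hr using fun z : f ⁻¹' range e => z.2
  have hrc : Continuous r := he.continuous_iff.2 <| by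
    have : e ∘ r = fun z => f z.1 := funext hr
    rw [this]
    exact hf.comp continuous_subtype_val
  let c : Y → f ⁻¹' range e := fun y => ⟨y, ⟨y, (hfe y).symm⟩⟩
  have hcc : Continuous c := hc.continuous.subtype_mk _
  have hleft : Function.LeftInverse r c := fun y =>
    he.injective ((hr (c y)).trans (hfe y))
  exact (hleft.isClosedEmbedding hrc hcc).polishSpace

theorem isInducing_mem_generateFrom {Y ι : Type*} (W : ι → Set Y) :
    @IsInducing Y (ι → Prop) (generateFrom (range W)) _ fun y i => y ∈ W i := by
  let := generateFrom (range W)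
  refine ⟨le_antisymm (continuous_iff_le_induced.1 ?_) (le_generateFrom ?_)⟩
  · exact continuous_pi fun i => continuous_Prop.2 (isOpen_generateFrom_of_mem ⟨i, rfl⟩)
  · rintro _ ⟨i, rfl⟩
    exact ⟨{p | p i}, continuous_Prop.1 (continuous_apply i), rfl⟩

theorem Continuous.exists_mem_basis_forall_mem {Y Z T : Type*} [TopologicalSpace Y]
    [TopologicalSpace Z] [TopologicalSpace T] {f : Y → Z → T}
    (hf : Continuous fun p : Y × Z => f p.1 p.2) {𝓤 : Set (Set Y)} {𝓥 : Set (Set Z)}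
    (h𝓤 : IsTopologicalBasis 𝓤) (h𝓥 : IsTopologicalBasis 𝓥) {O : Set T} (hO : IsOpen O)
    {y : Y} {z : Z} (h : f y z ∈ O) :
    ∃ U ∈ 𝓤, ∃ V ∈ 𝓥, y ∈ U ∧ z ∈ V ∧ ∀ u ∈ U, ∀ v ∈ V, f u v ∈ O := by
  obtain ⟨_, ⟨U, hU, V, hV, rfl⟩, ⟨hy, hz⟩, hsub⟩ :=
    (h𝓤.prod h𝓥).exists_subset_of_mem_open (a := (y, z)) (u := (fun p : Y × Z => f p.1 p.2) ⁻¹' O)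
      h (hO.preimage hf)
  exact ⟨U, hU, V, hV, hy, hz, fun u hu v hv => hsub (mk_mem_prod hu hv)⟩

theorem continuous_prod_generateFrom {Y Z T : Type*} [TopologicalSpace Y] [TopologicalSpace Z]
    {f : Y × Z → T} {S : Set (Set T)}
    (h : ∀ s ∈ S, ∀ y z, f (y, z) ∈ s → ∃ V, IsOpen V ∧ y ∈ V ∧ ∃ W, IsOpen W ∧ z ∈ W ∧
      ∀ v ∈ V, ∀ w ∈ W, f (v, w) ∈ s) : Continuous[_, generateFrom S] f := by
  refine continuous_generateFrom_iff.2 fun s hs => isOpen_prod_iff.2 fun y z hyz => ?_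
  obtain ⟨V, hV, hy, W, hW, hz, hVW⟩ := h s hs y z hyz
  exact ⟨V, W, hV, hW, hy, hz, fun p hp => hVW p.1 hp.1 p.2 hp.2⟩

/-! ### Completeness expressed by refinement of open sets. -/

/-- In a Polish space there are refinement relations between open sets such that every family of
nonempty open sets in which each member can be refined has a limit point in each of its members. -/
theorem exists_refinement {Y κ : Type*} [TopologicalSpace Y] [PolishSpace Y] (S : κ → Set Y) :
    ∃ R : ℕ → κ → κ → Prop,
      (∀ n i y, IsOpen (S i) → y ∈ S i →
        ∃ O, IsOpen O ∧ y ∈ O ∧ ∀ j, S j ⊆ O → R n i j) ∧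
      ∀ P : κ → Prop, (∀ i, P i → (S i).Nonempty) → (∀ n i, P i → ∃ j, R n i j ∧ P j) →
        ∀ i, P i → ∃ y ∈ S i, ∀ O, IsOpen O → y ∈ O → ∃ j, P j ∧ S j ⊆ O := by
  let := upgradeIsCompletelyMetrizable Y
  -- Along a chain of refinements closures are nested and the `n`-th step bounds distances by `2 *
  -- (1 / 2) ^ n`, so completeness supplies a limit lying in every member.
  refine ⟨fun n i j => closure (S j) ⊆ S i ∧ ∃ y, S j ⊆ Metric.closedBall y ((1 / 2 : ℝ) ^ n),
    ?_, ?_⟩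
  · intro n i y hi hy
    obtain ⟨ε, hε, hball⟩ := Metric.nhds_basis_closedBall.mem_iff.1 (hi.mem_nhds hy)
    refine ⟨Metric.ball y (min ε ((1 / 2 : ℝ) ^ n)), Metric.isOpen_ball,
      Metric.mem_ball_self (by positivity), fun j hj => ⟨?_, y, ?_⟩⟩
    · refine (closure_mono hj).trans (Metric.closure_ball_subset_closedBall.trans ?_)
      exact (Metric.closedBall_subset_closedBall (min_le_left _ _)).trans hball
    · exact hj.trans (Metric.ball_subset_closedBall.trans
        (Metric.closedBall_subset_closedBall (min_le_right _ _)))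
  · intro P hne hP i hi
    choose! next hR hPn using hP
    let s : ℕ → κ := fun n => Nat.rec i (fun n j => next n j) n
    have hs : ∀ n, P (s n) := fun n => by
      induction n with
      | zero => exact hi
      | succ n ih => exact hPn n _ ih
    have hsR := fun n => hR n (s n) (hs n)
    change ∀ n, closure (S (s (n + 1))) ⊆ S (s n) ∧
      ∃ y, S (s (n + 1)) ⊆ Metric.closedBall y ((1 / 2 : ℝ) ^ n) at hsR
    have hanti : ∀ {m n}, m ≤ n → S (s n) ⊆ S (s m) := fun hmn =>
      antitone_nat_of_succ_le (f := fun n => S (s n))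
        (fun n => subset_closure.trans (hsR n).1) hmn
    choose y hy using fun n => hne _ (hs n)
    have hdist : ∀ n, ∀ a ∈ S (s (n + 1)), ∀ b ∈ S (s (n + 1)),
        dist a b ≤ 2 * (1 / 2 : ℝ) ^ n := by
      intro n a ha b hb
      obtain ⟨c, hc⟩ := (hsR n).2
      have h1 := hc ha
      have h2 := hc hb
      rw [Metric.mem_closedBall] at h1 h2
      linarith [dist_triangle_right a b c]
    have hlim0 : Tendsto (fun n => 2 * (1 / 2 : ℝ) ^ n) atTop (𝓝 0) := by
      simpa using (tendsto_pow_atTop_nhds_zero_of_lt_one (by norm_num : (0 : ℝ) ≤ 1 / 2)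
        (by norm_num)).const_mul 2
    have hcauchy : CauchySeq fun n => y (n + 1) :=
      cauchySeq_of_le_tendsto_0 (fun n => 2 * (1 / 2 : ℝ) ^ n) (fun n m N hn hm =>
        hdist N _ (hanti (Nat.succ_le_succ hn) (hy (n + 1))) _
          (hanti (Nat.succ_le_succ hm) (hy (m + 1)))) hlim0
    obtain ⟨z, hz⟩ := cauchySeq_tendsto_of_complete hcauchy
    have hzS : ∀ n, z ∈ S (s n) := fun n => (hsR n).1 <|
      mem_closure_of_tendsto hz <| (eventually_ge_atTop n).mono fun m hm =>
        hanti (Nat.succ_le_succ hm) (hy (m + 1))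
    refine ⟨z, hzS 0, fun O hO hzO => ?_⟩
    obtain ⟨ε, hε, hball⟩ := Metric.isOpen_iff.1 hO z hzO
    obtain ⟨n, hn⟩ := (hlim0.eventually (gt_mem_nhds hε)).exists
    exact ⟨s (n + 1), hs (n + 1), fun a ha => hball ((hdist n a ha z (hzS (n + 1))).trans_lt hn)⟩

theorem exists_refinement_prod {Y Z : Type*} [TopologicalSpace Y] [PolishSpace Y]
    [TopologicalSpace Z] [PolishSpace Z] {𝓤 : Set (Set Y)} {𝓥 : Set (Set Z)}
    (h𝓤 : IsTopologicalBasis 𝓤) (h𝓥 : IsTopologicalBasis 𝓥) :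
    ∃ R : ℕ → 𝓤 × 𝓥 → 𝓤 × 𝓥 → Prop,
      (∀ n i, ∀ y ∈ i.1.1, ∀ z ∈ i.2.1, ∃ j, R n i j ∧ y ∈ j.1.1 ∧ z ∈ j.2.1) ∧
      ∀ P : 𝓤 × 𝓥 → Prop, (∀ i, P i → i.1.1.Nonempty ∧ i.2.1.Nonempty) →
        (∀ n i, P i → ∃ j, R n i j ∧ P j) → ∀ i, P i → ∃ y ∈ i.1.1, ∃ z ∈ i.2.1,
          ∀ k : 𝓤 × 𝓥, y ∈ k.1.1 → z ∈ k.2.1 → ∃ j, P j ∧ j.1.1 ⊆ k.1.1 ∧ j.2.1 ⊆ k.2.1 := by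
  have hopen : ∀ i : 𝓤 × 𝓥, IsOpen (i.1.1 ×ˢ i.2.1) := fun i =>
    (h𝓤.isOpen i.1.2).prod (h𝓥.isOpen i.2.2)
  obtain ⟨R, hR₁, hR₂⟩ := exists_refinement fun i : 𝓤 × 𝓥 => i.1.1 ×ˢ i.2.1
  refine ⟨R, fun n i y hy z hz => ?_, fun P hne hP i hi => ?_⟩
  · obtain ⟨O, hO, hyz, h⟩ := hR₁ n i (y, z) (hopen i) ⟨hy, hz⟩
    obtain ⟨_, ⟨U, hU, V, hV, rfl⟩, ⟨hyU, hzV⟩, hsub⟩ :=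
      (h𝓤.prod h𝓥).exists_subset_of_mem_open hyz hO
    exact ⟨(⟨U, hU⟩, ⟨V, hV⟩), h _ hsub, hyU, hzV⟩
  · obtain ⟨⟨y, z⟩, ⟨hy, hz⟩, h⟩ := hR₂ P (fun i hi => (hne i hi).1.prod (hne i hi).2) hP i hi
    refine ⟨y, hy, z, hz, fun k hy hz => ?_⟩
    obtain ⟨j, hj, hsub⟩ := h _ (hopen k) ⟨hy, hz⟩
    -- Inclusion of boxes splits into factors only because members of `P` have nonempty factors.
    exact ⟨j, hj, (prod_subset_prod_iff.1 hsub).resolve_right fun h =>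
      h.elim (hne j hj).1.ne_empty (hne j hj).2.ne_empty⟩

/-! ### Countable families of Borel sets as bases of Polish topologies. -/

/-- A countable family of Borel sets consists of open sets for some finer Polish topology. -/
theorem exists_polishSpace_forall_isOpen {X : Type*} [t : TopologicalSpace X] [PolishSpace X]
    [MeasurableSpace X] [BorelSpace X] {𝓢 : Set (Set X)} (hc : 𝓢.Countable)
    (hm : ∀ A ∈ 𝓢, MeasurableSet A) :
    ∃ σ : TopologicalSpace X, σ ≤ t ∧ @PolishSpace X σ ∧ ∀ A ∈ 𝓢, IsOpen[σ] A := by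
  have := hc.to_subtype
  choose m hmt hmP _ hmo using fun A : 𝓢 => (hm A A.2).isClopenable
  obtain ⟨σ, hσm, hσt, hσ⟩ := PolishSpace.exists_polishSpace_forall_le m hmt hmP
  exact ⟨σ, hσt, hσ, fun A hA => hσm ⟨A, hA⟩ _ (hmo ⟨A, hA⟩)⟩

/-- A countable family of Borel sets can be enlarged to a countable family of Borel sets that is
closed under a given set of countably many operations and is a basis of a Polish topology. -/
theorem exists_countable_isTopologicalBasis {X : Type*} [t : TopologicalSpace X] [PolishSpace X]
    [MeasurableSpace X] [BorelSpace X] (Φ : Set X → Set (Set X)) (hΦc : ∀ A, (Φ A).Countable)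
    (hΦm : ∀ A, MeasurableSet A → ∀ A' ∈ Φ A, MeasurableSet A') {𝓢 : Set (Set X)}
    (hc : 𝓢.Countable) (hm : ∀ A ∈ 𝓢, MeasurableSet A) :
    ∃ 𝓑 : Set (Set X), 𝓢 ⊆ 𝓑 ∧ 𝓑.Countable ∧ (∀ A ∈ 𝓑, MeasurableSet A) ∧
      (∀ A ∈ 𝓑, Φ A ⊆ 𝓑) ∧
      ∃ σ : TopologicalSpace X, @PolishSpace X σ ∧ @IsTopologicalBasis X σ 𝓑 := by
  let F := {𝓢 : Set (Set X) // 𝓢.Countable ∧ ∀ A ∈ 𝓢, MeasurableSet A}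
  have hborel : ‹MeasurableSpace X› = @borel X t := BorelSpace.measurable_eq
  -- Each stage makes the current family open in a Polish topology `σ` and adds a countable basis of
  -- `σ`. The stages interleave, so the union of the families generates the infimum of the
  -- topologies, which is again Polish.
  have hstep : ∀ 𝓢 : F, ∃ 𝓣 : F, 𝓢.1 ⊆ 𝓣.1 ∧ (∀ A ∈ 𝓢.1, Φ A ⊆ 𝓣.1) ∧
      (∀ A ∈ 𝓢.1, ∀ A' ∈ 𝓢.1, A ∩ A' ∈ 𝓣.1) ∧
      ∃ σ : TopologicalSpace X, σ ≤ t ∧ @PolishSpace X σ ∧ (∀ A ∈ 𝓢.1, IsOpen[σ] A) ∧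
        generateFrom 𝓣.1 ≤ σ := by
    rintro ⟨𝓢, hc, hm⟩
    obtain ⟨σ, hσt, hσ, hσo⟩ := exists_polishSpace_forall_isOpen hc hm
    obtain ⟨b, hbc, -, hb⟩ := @exists_countable_basis X σ inferInstance
    have hbm : ∀ A ∈ b, MeasurableSet A := fun A hA => by
      have : IsOpen[σ] A := hb.isOpen hA
      rw [hborel, ← MeasureTheory.borel_eq_borel_of_le hσ ‹_› hσt]
      exact MeasurableSpace.measurableSet_generateFrom this
    refine ⟨⟨𝓢 ∪ (⋃ A ∈ 𝓢, Φ A) ∪ image2 (· ∩ ·) 𝓢 𝓢 ∪ b, ?_, ?_⟩, ?_, ?_, ?_, σ, hσt, hσ, hσo, ?_⟩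
    · exact ((hc.union (hc.biUnion fun A _ => hΦc A)).union (hc.image2 hc _)).union hbc
    · rintro A (((hA | hA) | ⟨C, hC, D, hD, rfl⟩) | hA)
      · exact hm A hA
      · simp only [mem_iUnion] at hA
        obtain ⟨C, hC, hA⟩ := hA
        exact hΦm C (hm C hC) A hA
      · exact (hm C hC).inter (hm D hD)
      · exact hbm A hA
    · exact fun A hA => Or.inl (Or.inl (Or.inl hA))
    · exact fun A hA C hC => Or.inl (Or.inl (Or.inr (mem_biUnion hA hC)))
    · exact fun A hA C hC => Or.inl (Or.inr (mem_image2_of_mem hA hC))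
    · rw [hb.eq_generateFrom]
      exact generateFrom_anti fun A hA => Or.inr hA
  choose next hsub hΦ hinter σ hσt hσ hσo hσg using hstep
  let s : ℕ → F := fun n => Nat.rec
    ⟨insert univ 𝓢, hc.insert _, by
      rintro A (rfl | hA)
      exacts [MeasurableSet.univ, hm A hA]⟩ (fun _ 𝓣 => next 𝓣) n
  have hsucc : ∀ n, s (n + 1) = next (s n) := fun n => rfl
  have hmono : Monotone fun n => (s n).1 := monotone_nat_of_le_succ fun n => hsub (s n)
  have hmem : ∀ n, ∀ A ∈ (s n).1, A ∈ ⋃ n, (s n).1 := fun n A hA => mem_iUnion.2 ⟨n, hA⟩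
  have huniv : univ ∈ ⋃ n, (s n).1 := hmem 0 _ (mem_insert _ _)
  refine ⟨⋃ n, (s n).1, fun A hA => hmem 0 A (mem_insert_of_mem _ hA),
    countable_iUnion fun n => (s n).2.1, ?_, ?_, ⨅ o : Option ℕ, o.elim t fun n => σ (s n), ?_, ?_⟩
  · intro A hA
    obtain ⟨n, hA⟩ := mem_iUnion.1 hA
    exact (s n).2.2 A hA
  · intro A hA C hC
    obtain ⟨n, hA⟩ := mem_iUnion.1 hA
    exact hmem (n + 1) C (hΦ (s n) A hA hC)
  · exact PolishSpace.iInf ⟨none, Option.forall.2 ⟨le_rfl, fun n => hσt _⟩⟩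
      (Option.forall.2 ⟨‹_›, fun n => hσ _⟩)
  · have hgen : (⨅ o : Option ℕ, o.elim t fun n => σ (s n)) = generateFrom (⋃ n, (s n).1) := by
      have hle : ∀ n, generateFrom (⋃ n, (s n).1) ≤ σ (s n) := fun n =>
        (generateFrom_anti fun A hA => hmem (n + 1) A hA).trans (hσg (s n))
      refine le_antisymm (le_generateFrom fun A hA => ?_) (le_iInf (Option.forall.2 ⟨?_, hle⟩))
      · obtain ⟨n, hA⟩ := mem_iUnion.1 hA
        exact iInf_le (fun o : Option ℕ => o.elim t fun n => σ (s n)) (some n) _ (hσo _ _ hA)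
      · exact (hle 0).trans (hσt _)
    rw [← insert_eq_of_mem huniv]
    refine @isTopologicalBasis_of_subbasis_of_inter X (_) _ hgen fun A hA C hC => ?_
    obtain ⟨n, hA⟩ := mem_iUnion.1 hA
    obtain ⟨m, hC⟩ := mem_iUnion.1 hC
    exact hmem (max n m + 1) _
      (hinter _ _ (hmono (le_max_left n m) hA) _ (hmono (le_max_right n m) hC))
-- Baire category and Vaught transforms.
-- By the Baire property, `S` agrees with an open set `O` up to a meagre set, and `U ∩ O` cannot be
-- empty.
theorem exists_basis_subset_isMeagre_diff {Y : Type*} [TopologicalSpace Y] {𝓤 : Set (Set Y)}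
    (h𝓤 : IsTopologicalBasis 𝓤) {U S : Set Y} (hU : IsOpen U) (hS : BaireMeasurableSet S)
    (h : ¬ IsMeagre (U ∩ S)) : ∃ W ∈ 𝓤, W.Nonempty ∧ W ⊆ U ∧ IsMeagre (W \ S) := by
  obtain ⟨O, hO, hSO⟩ := hS.residualEq_isOpen
  have hM : IsMeagre {y | ¬ (y ∈ S ↔ y ∈ O)} := by
    rw [IsMeagre]
    filter_upwards [eventuallyEq_set.1 hSO] with y hy
    simpa using hy
  have hne : (U ∩ O).Nonempty := by
    by_contra hcon
    exact h (hM.mono (show U ∩ S ⊆ {y | ¬ (y ∈ S ↔ y ∈ O)} from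
      fun y hy hiff => hcon ⟨y, hy.1, hiff.1 hy.2⟩))
  obtain ⟨y, hy⟩ := hne
  obtain ⟨W, hW, hyW, hsub⟩ := h𝓤.exists_subset_of_mem_open hy (hU.inter hO)
  exact ⟨W, hW, ⟨y, hyW⟩, hsub.trans inter_subset_left,
    hM.mono (show W \ S ⊆ {y | ¬ (y ∈ S ↔ y ∈ O)} from
      fun z hz hiff => hz.2 (hiff.2 (hsub hz.1).2))⟩

/-- The Vaught transform: the points `x` such that `g • x ∈ A` for nonmeagerly many `g ∈ U`. -/
def vaught {G X : Type*} [TopologicalSpace G] [SMul G X] (U : Set G) (A : Set X) : Set X :=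
  {x | ¬ IsMeagre (U ∩ {g | g • x ∈ A})}

section Vaught

variable {G X : Type*} [Group G] [TopologicalSpace G] [MulAction G X] {U W : Set G} {A A' : Set X}
  {x : X}

theorem vaught_mono (hU : U ⊆ W) (hA : A ⊆ A') : vaught U A ⊆ vaught W A' :=
  fun _ hx h => hx (h.mono (inter_subset_inter hU fun _ hg => hA hg))

theorem exists_smul_mem_of_mem_vaught (h : x ∈ vaught U A) : ∃ g ∈ U, g • x ∈ A :=
  nonempty_of_not_isMeagre h

/-- A pigeonhole principle: a nonmeagre set covered by countably many pieces has a nonmeagre piece.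
-/
theorem exists_mem_vaught_of_cover {𝓤 : Set (Set G)} {𝓒 : Set (Set X)} (h𝓤 : 𝓤.Countable)
    (h𝓒 : 𝓒.Countable) {p : Set G → Set X → Prop} (h : x ∈ vaught U A)
    (hcover : ∀ g ∈ U, g • x ∈ A → ∃ W ∈ 𝓤, ∃ C ∈ 𝓒, g ∈ W ∧ g • x ∈ C ∧ p W C) :
    ∃ W ∈ 𝓤, ∃ C ∈ 𝓒, p W C ∧ x ∈ vaught W C := by
  by_contra! hcon
  refine h ((isMeagre_biUnion (h𝓤.prod h𝓒 |>.mono (sep_subset _ fun q => p q.1 q.2))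
    (f := fun q => q.1 ∩ {g | g • x ∈ q.2}) fun q hq =>
      not_not.1 (hcon q.1 hq.1.1 q.2 hq.1.2 hq.2)).mono fun g hg => ?_)
  obtain ⟨W, hW, C, hC, hgW, hgC, hp⟩ := hcover g hg.1 hg.2
  exact mem_biUnion (x := (W, C)) ⟨⟨hW, hC⟩, hp⟩ ⟨hgW, hgC⟩

theorem exists_mem_vaught_of_cover_left {𝓤 : Set (Set G)} (h𝓤 : 𝓤.Countable)
    {p : Set G → Prop} (h : x ∈ vaught U A)
    (hcover : ∀ g ∈ U, ∃ W ∈ 𝓤, g ∈ W ∧ p W) : ∃ W ∈ 𝓤, p W ∧ x ∈ vaught W A := by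
  obtain ⟨W, hW, _, rfl, hp, hx⟩ := exists_mem_vaught_of_cover h𝓤 (countable_singleton A)
    (p := fun W _ => p W) h fun g hg hgA => by
      obtain ⟨W, hW, hgW, hp⟩ := hcover g hg
      exact ⟨W, hW, A, rfl, hgW, hgA, hp⟩
  exact ⟨W, hW, hp, hx⟩

theorem mem_vaught_of_forall [BaireSpace G] (hU : IsOpen U) (hne : U.Nonempty)
    (h : ∀ g ∈ U, g • x ∈ A) : x ∈ vaught U A := fun hm =>
  not_isMeagre_of_isOpen hU hne (hm.mono (show U ⊆ U ∩ {g | g • x ∈ A} from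
    fun g hg => ⟨hg, h g hg⟩))

theorem mem_vaught_of_notMem_compl [BaireSpace G] (hU : IsOpen U) (hne : U.Nonempty)
    (h : x ∉ vaught U Aᶜ) : x ∈ vaught U A := fun hm => by
  refine not_isMeagre_of_isOpen hU hne ((hm.union (not_not.1 h)).mono fun g hg => ?_)
  by_cases hgA : g • x ∈ A
  exacts [Or.inl ⟨hg, hgA⟩, Or.inr ⟨hg, hgA⟩]

theorem vaught_eq_self_of_invariant [BaireSpace G] (hU : IsOpen U) (hne : U.Nonempty)
    (hA : ∀ g : G, ∀ x ∈ A, g • x ∈ A) : vaught U A = A := by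
  ext x
  refine ⟨fun h => ?_, fun h => mem_vaught_of_forall hU hne fun g _ => hA g x h⟩
  obtain ⟨g, -, hg⟩ := exists_smul_mem_of_mem_vaught h
  simpa using hA g⁻¹ _ hg

/-- Right translation by `g⁻¹` is a homeomorphism of `G`, so it preserves meagreness. -/
theorem smul_mem_vaught [IsTopologicalGroup G] {g : G} (h : x ∈ vaught W A)
    (hWU : ∀ w ∈ W, w * g⁻¹ ∈ U) : g • x ∈ vaught U A := fun hm => by
  have hsub : W ∩ {k | k • x ∈ A} ⊆ (· * g⁻¹) ⁻¹' (U ∩ {h | h • g • x ∈ A}) :=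
    fun w hw => ⟨hWU w hw.1, by simpa [smul_smul] using hw.2⟩
  exact h ((hm.preimage_of_isOpenMap (by fun_prop) (isOpenMap_mul_right g⁻¹)).mono hsub)

theorem mem_vaught_of_smul [IsTopologicalGroup G] {g : G} (h : g • x ∈ vaught U A)
    (hUW : ∀ u ∈ U, u * g ∈ W) : x ∈ vaught W A := by
  simpa using smul_mem_vaught (g := g⁻¹) h (by simpa using hUW)

/-- With `smul_mem_vaught`, this makes `V` and `vaught W A` neighbourhoods of `g` and `x` whose
product acts into `vaught U A`. -/
theorem exists_mem_vaught_of_smul [IsTopologicalGroup G] {𝓤 : Set (Set G)}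
    (h𝓤 : IsTopologicalBasis 𝓤) (hc : 𝓤.Countable) (hU : IsOpen U) {g : G}
    (h : g • x ∈ vaught U A) :
    ∃ W ∈ 𝓤, ∃ V ∈ 𝓤, g ∈ V ∧ (∀ w ∈ W, ∀ v ∈ V, w * v⁻¹ ∈ U) ∧ x ∈ vaught W A := by
  have h' : x ∈ vaught ((· * g⁻¹) ⁻¹' U) A := mem_vaught_of_smul h (by simp)
  obtain ⟨W, hW, ⟨V, hV, hgV, hWV⟩, hx⟩ := exists_mem_vaught_of_cover_left hc
    (p := fun W => ∃ V ∈ 𝓤, g ∈ V ∧ ∀ w ∈ W, ∀ v ∈ V, w * v⁻¹ ∈ U) h' fun k hk => by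
      obtain ⟨W, hW, V, hV, hkW, hgV, hWV⟩ := Continuous.exists_mem_basis_forall_mem
        (f := fun w v : G => w * v⁻¹) (by fun_prop) h𝓤 h𝓤 hU hk
      exact ⟨W, hW, hkW, V, hV, hgV, hWV⟩
  exact ⟨W, hW, V, hV, hgV, hWV, hx⟩

theorem vaught_vaught_subset [IsTopologicalGroup G] {V : Set G}
    (hUV : ∀ w ∈ W, ∀ v ∈ V, w * v ∈ U) : vaught V (vaught W A) ⊆ vaught U A := fun x hx => by
  obtain ⟨v, hv, hvx⟩ := exists_smul_mem_of_mem_vaught hx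
  exact mem_vaught_of_smul hvx fun w hw => hUV w hw v hv

/-- A converse to `vaught_vaught_subset`: together they write `vaught U A` as a union of iterated
transforms. -/
theorem exists_mem_vaught_vaught [IsTopologicalGroup G] [BaireSpace G] {𝓤 : Set (Set G)}
    (h𝓤 : IsTopologicalBasis 𝓤) (hc : 𝓤.Countable) (hU : IsOpen U) (h : x ∈ vaught U A) :
    ∃ W ∈ 𝓤, ∃ V ∈ 𝓤, (∀ w ∈ W, ∀ v ∈ V, w * v ∈ U) ∧ x ∈ vaught V (vaught W A) := by
  obtain ⟨W, hW, ⟨V, hV, h1V, hWV⟩, hx⟩ := exists_mem_vaught_of_cover_left hc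
    (p := fun W => ∃ V ∈ 𝓤, 1 ∈ V ∧ ∀ w ∈ W, ∀ v ∈ V, w * v ∈ U) h fun k hk => by
      obtain ⟨W, hW, V, hV, hkW, h1V, hWV⟩ := Continuous.exists_mem_basis_forall_mem
        (f := fun w v : G => w * v) (y := k) (z := 1) (by fun_prop) h𝓤 h𝓤 hU (by simpa using hk)
      exact ⟨W, hW, hkW, V, hV, h1V, hWV⟩
  rw [← one_smul G x] at hx
  obtain ⟨W', hW', V', hV', h1V', hWV', hx⟩ :=
    exists_mem_vaught_of_smul h𝓤 hc (h𝓤.isOpen hW) hx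
  obtain ⟨N, hN, h1N, hNV⟩ := h𝓤.exists_subset_of_mem_open (show 1 ∈ V ∩ V' from ⟨h1V, h1V'⟩)
    ((h𝓤.isOpen hV).inter (h𝓤.isOpen hV'))
  refine ⟨W, hW, N, hN, fun w hw v hv => hWV w hw v (hNV hv).1, ?_⟩
  exact mem_vaught_of_forall (h𝓤.isOpen hN) ⟨1, h1N⟩ fun v hv =>
    smul_mem_vaught hx fun w hw => hWV' w hw v (hNV hv).2

theorem vaught_iUnion {ι : Type*} [Countable ι] {f : ι → Set X} :
    vaught U (⋃ i, f i) = ⋃ i, vaught U (f i) := by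
  refine subset_antisymm (fun x hx => ?_)
    (iUnion_subset fun i => vaught_mono subset_rfl (subset_iUnion f i))
  obtain ⟨_, rfl, _, ⟨i, rfl⟩, -, h⟩ := exists_mem_vaught_of_cover (countable_singleton U)
    (countable_range f) (p := fun _ _ => True) hx fun g hg hgx => by
      obtain ⟨i, hi⟩ := mem_iUnion.1 hgx
      exact ⟨U, rfl, f i, mem_range_self i, hg, hi, trivial⟩
  exact mem_iUnion.2 ⟨i, h⟩

theorem isOpen_vaught [BaireSpace G] [TopologicalSpace X] [ContinuousSMul G X] (hU : IsOpen U) (hA : IsOpen A) : IsOpen (vaught U A) := by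
  have : vaught U A = ⋃ g ∈ U, (g • ·) ⁻¹' A := by
    ext x
    simp only [mem_iUnion, mem_preimage, exists_prop]
    refine ⟨exists_smul_mem_of_mem_vaught, fun ⟨g, hg, hgx⟩ => ?_⟩
    have hopen : IsOpen (U ∩ {g : G | g • x ∈ A}) := hU.inter (hA.preimage (by fun_prop))
    exact not_isMeagre_of_isOpen hopen ⟨g, hg, hgx⟩
  rw [this]
  exact isOpen_biUnion fun g _ => hA.preimage (continuous_const_smul g)

section Borel

variable [TopologicalSpace X] [MeasurableSpace X] [BorelSpace X] [ContinuousSMul G X]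

theorem exists_notMem_vaught_compl {𝓤 : Set (Set G)} (h𝓤 : IsTopologicalBasis 𝓤) (hU : IsOpen U)
    (hA : MeasurableSet A) (h : x ∈ vaught U A) :
    ∃ W ∈ 𝓤, W.Nonempty ∧ W ⊆ U ∧ x ∉ vaught W Aᶜ := by
  borelize G
  have hS : MeasurableSet {g : G | g • x ∈ A} :=
    (by fun_prop : Continuous fun g : G => g • x).measurable hA
  obtain ⟨W, hW, hne, hWU, hm⟩ :=
    exists_basis_subset_isMeagre_diff h𝓤 hU hS.baireMeasurableSet h
  exact ⟨W, hW, hne, hWU, not_not.2 hm⟩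

/-- Expresses the "comeagrely many" transform through countably many "nonmeagrely many" ones when
`𝓤` is countable; this is the complement step in the Borel induction. -/
theorem compl_vaught_compl [BaireSpace G] {𝓤 : Set (Set G)} (h𝓤 : IsTopologicalBasis 𝓤)
    (hU : IsOpen U) (hA : MeasurableSet A) :
    (vaught U Aᶜ)ᶜ = ⋂ W ∈ {W ∈ 𝓤 | W.Nonempty ∧ W ⊆ U}, vaught W A := by
  ext x
  simp only [mem_iInter]
  refine ⟨fun h W hW => mem_vaught_of_notMem_compl (h𝓤.isOpen hW.1) hW.2.1 fun hx =>
    h (vaught_mono hW.2.2 subset_rfl hx), fun h hx => ?_⟩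
  obtain ⟨W, hW, hne, hWU, hxW⟩ := exists_notMem_vaught_compl h𝓤 hU hA.compl hx
  rw [compl_compl] at hxW
  exact hxW (h W ⟨hW, hne, hWU⟩)

/-- The Vaught transform of a Borel set is Borel. -/
theorem MeasurableSet.vaught [BaireSpace G] [SecondCountableTopology G] (hU : IsOpen U)
    (hA : MeasurableSet A) : MeasurableSet (vaught U A) := by
  induction A, hA using MeasurableSet.induction_on_open generalizing U with
  | isOpen A hA => exact (isOpen_vaught hU hA).measurableSet
  | compl A hA ih =>
    rw [← compl_compl (_root_.vaught U Aᶜ),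
      compl_vaught_compl (isBasis_countableBasis G) hU hA]
    exact (MeasurableSet.biInter ((countable_countableBasis G).mono (sep_subset _ _))
      fun W hW => ih (isOpen_of_mem_countableBasis hW.1)).compl
  | iUnion f _ _ ih =>
    rw [vaught_iUnion]
    exact MeasurableSet.iUnion fun n => ih n hU

end Borel

end Vaught
-- The topology generated by Vaught transforms.
/-- Closure properties of a countable family `𝓑` of Borel sets, relative to a basis `𝓤` of `G`,
under which the Vaught transforms `vaught U A` generate a topology suited to the action. -/
structure IsVaughtFamily {G X : Type*} [Group G] [TopologicalSpace G] [MulAction G X]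
    [TopologicalSpace X] [MeasurableSpace X] (𝓤 : Set (Set G)) (𝓑 : Set (Set X)) : Prop where
  isTopologicalBasis_left : IsTopologicalBasis 𝓤
  countable_left : 𝓤.Countable
  nonempty_of_mem : ∀ U ∈ 𝓤, U.Nonempty
  isTopologicalBasis_isOpen : IsTopologicalBasis {A ∈ 𝓑 | IsOpen A}
  countable_right : 𝓑.Countable
  measurableSet : ∀ A ∈ 𝓑, MeasurableSet A
  compl_mem : ∀ A ∈ 𝓑, Aᶜ ∈ 𝓑
  vaught_mem : ∀ A ∈ 𝓑, ∀ U ∈ 𝓤, vaught U A ∈ 𝓑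

/-- The topology generated by the Vaught transforms of the members of a family of sets. -/
@[reducible] def vaughtTopology {G X : Type*} [TopologicalSpace G] [SMul G X] (𝓤 : Set (Set G))
    (𝓑 : Set (Set X)) : TopologicalSpace X :=
  generateFrom (range fun i : 𝓤 × 𝓑 => vaught i.1.1 i.2.1)

theorem isOpen_vaughtTopology {G X : Type*} [TopologicalSpace G] [SMul G X] {𝓤 : Set (Set G)}
    {𝓑 : Set (Set X)} {U : Set G} {A : Set X} (hU : U ∈ 𝓤) (hA : A ∈ 𝓑) :
    IsOpen[vaughtTopology 𝓤 𝓑] (vaught U A) :=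
  isOpen_generateFrom_of_mem ⟨(⟨U, hU⟩, ⟨A, hA⟩), rfl⟩

theorem isGδ_setOf_code {Z ι : Type*} [TopologicalSpace Z] [MetrizableSpace Z] [Countable ι]
    {f : Z → ι → Prop} (hf : Continuous f) (D M Q : ι → ι → Prop) (R : ℕ → ι → ι → Prop) :
    IsGδ {z | (∃ i, f z i) ∧ (∀ i j, D i j → f z i → ¬ f z j) ∧
      (∀ n i, f z i → ∃ j, R n i j ∧ f z j) ∧ (∀ i j, M i j → f z i → f z j) ∧
      ∀ j, f z j → ∃ i, Q i j ∧ f z i} := by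
  have ho : ∀ i, IsOpen {z | f z i} := fun i =>
    continuous_Prop.1 ((continuous_apply i).comp hf)
  have hex : ∀ q : ι → Prop, IsOpen {z | ∃ i, q i ∧ f z i} := fun q => by
    have : {z | ∃ i, q i ∧ f z i} = ⋃ i ∈ {i | q i}, {z | f z i} := by
      ext z
      simp
    rw [this]
    exact isOpen_biUnion fun i _ => ho i
  have hdisj : ∀ i j, IsGδ {z | f z i → ¬ f z j} := fun i j => by
    have : {z | f z i → ¬ f z j} = {z | f z i ∧ f z j → False} := by
      ext z
      simp
    rw [this]
    exact IsOpen.isGδ_imp ((ho i).inter (ho j)) (by simp)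
  have hsome : IsOpen {z | ∃ i, f z i} := by simpa using hex fun _ => True
  simp only [ofPred_and, ofPred_forall]
  refine hsome.isGδ.inter (.inter ?_ (.inter ?_ (.inter ?_ ?_)))
  · exact .iInter fun i => .iInter fun j => .iInter fun _ => hdisj i j
  · exact .iInter fun n => .iInter fun i => (ho i).isGδ_imp (hex _)
  · exact .iInter fun i => .iInter fun j => .iInter fun _ => (ho i).isGδ_imp (ho j)
  · exact .iInter fun j => (ho j).isGδ_imp (hex _)

namespace IsVaughtFamily

variable {G X : Type*} [Group G] [TopologicalSpace G] [MulAction G X]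
  [t : TopologicalSpace X] [MeasurableSpace X] {𝓤 : Set (Set G)} {𝓑 : Set (Set X)}

theorem continuous_smul [IsTopologicalGroup G] (h : IsVaughtFamily 𝓤 𝓑) :
    @Continuous (G × X) X (@instTopologicalSpaceProd G X _ (vaughtTopology 𝓤 𝓑))
      (vaughtTopology 𝓤 𝓑) (fun p => p.1 • p.2) := by
  refine @continuous_prod_generateFrom G X X _ (vaughtTopology 𝓤 𝓑) _ _ ?_
  rintro _ ⟨⟨⟨U, hU⟩, ⟨A, hA⟩⟩, rfl⟩ g x hgx
  obtain ⟨W, hW, V, hV, hgV, hWV, hx⟩ := exists_mem_vaught_of_smul h.isTopologicalBasis_left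
    h.countable_left (h.isTopologicalBasis_left.isOpen hU) hgx
  exact ⟨V, h.isTopologicalBasis_left.isOpen hV, hgV, vaught W A, isOpen_vaughtTopology hW hA, hx,
    fun v hv z hz => smul_mem_vaught hz fun w hw => hWV w hw v hv⟩

variable [BaireSpace G]

theorem isClopen_of_invariant (h : IsVaughtFamily 𝓤 𝓑) {B : Set X} (hB : B ∈ 𝓑)
    (hinv : ∀ g : G, ∀ x ∈ B, g • x ∈ B) : @IsClopen X (vaughtTopology 𝓤 𝓑) B := by
  obtain ⟨U, hU, -⟩ := h.isTopologicalBasis_left.exists_subset_of_mem_open (mem_univ (1 : G))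
    isOpen_univ
  have hUo := h.isTopologicalBasis_left.isOpen hU
  have hUne := h.nonempty_of_mem U hU
  have hinv' : ∀ g : G, ∀ x ∈ Bᶜ, g • x ∈ Bᶜ := fun g x hx hgx =>
    hx (by simpa using hinv g⁻¹ _ hgx)
  have h₁ := isOpen_vaughtTopology hU hB
  have h₂ := isOpen_vaughtTopology hU (h.compl_mem B hB)
  rw [vaught_eq_self_of_invariant hUo hUne hinv] at h₁
  rw [vaught_eq_self_of_invariant hUo hUne hinv'] at h₂
  exact ⟨(@isOpen_compl_iff X _ (vaughtTopology 𝓤 𝓑)).1 h₂, h₁⟩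

variable [IsTopologicalGroup G] [ContinuousSMul G X]

/-- If `U⁻¹ • A ⊆ O` with `1 ∈ U` and `x ∈ A`, then every transform `vaught V A` with `V ⊆ U` lies
in `O`, and for small `V ∋ 1` it contains `x`. -/
theorem vaughtTopology_le (h : IsVaughtFamily 𝓤 𝓑) : vaughtTopology 𝓤 𝓑 ≤ t := by
  intro O hO
  refine (@isOpen_iff_forall_mem_open X (vaughtTopology 𝓤 𝓑) O).2 fun x hx => ?_
  obtain ⟨U, hU, A, hA, h1U, hxA, hUA⟩ := Continuous.exists_mem_basis_forall_mem
    (f := fun (g : G) (x : X) => g⁻¹ • x) (y := 1) (z := x) (by fun_prop) h.isTopologicalBasis_left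
    h.isTopologicalBasis_isOpen hO (by simpa using hx)
  obtain ⟨V, hV, h1V, hVU⟩ := h.isTopologicalBasis_left.exists_subset_of_mem_open (a := (1 : G))
    (u := U ∩ (· • x) ⁻¹' A) ⟨h1U, by simpa using hxA⟩
    ((h.isTopologicalBasis_left.isOpen hU).inter (hA.2.preimage (by fun_prop)))
  refine ⟨vaught V A, fun y hy => ?_, isOpen_vaughtTopology hV hA.1,
    mem_vaught_of_forall (h.isTopologicalBasis_left.isOpen hV) ⟨1, h1V⟩ fun g hg => (hVU hg).2⟩
  obtain ⟨g, hg, hgy⟩ := exists_smul_mem_of_mem_vaught hy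
  simpa using hUA g (hVU hg).1 _ hgy

/-- Some nonempty `W₁ ⊆ U` has `g • x ∈ A` for comeagrely many `g ∈ W₁`. Shrinking to `W₂` and `W₃`
leaves room for translation by a neighbourhood `V` of `1`: `vaught W₃ Aᶜ` contains the complement of
`vaught U A`, while `vaught V (vaught W₂ Aᶜ)ᶜ` contains `x`, and `W₃ V⁻¹ ⊆ W₂` makes them disjoint.
-/
theorem regularSpace [BorelSpace X] (h : IsVaughtFamily 𝓤 𝓑) : @RegularSpace X (vaughtTopology 𝓤 𝓑) := by
  have hb := h.isTopologicalBasis_left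
  refine (@regularSpace_generateFrom X (vaughtTopology 𝓤 𝓑) _ rfl).2 ?_
  rintro _ ⟨⟨⟨U, hU⟩, ⟨A, hA⟩⟩, rfl⟩ x hx
  change x ∈ vaught U A at hx
  obtain ⟨W₁, hW₁, ⟨w, hw⟩, hW₁U, hxW₁⟩ :=
    exists_notMem_vaught_compl hb (hb.isOpen hU) (h.measurableSet A hA) hx
  obtain ⟨W₂, hW₂, V₁, hV₁, hwW₂, h1V₁, hWV₁⟩ := Continuous.exists_mem_basis_forall_mem
    (f := fun w v : G => w * v) (y := w) (z := 1) (by fun_prop) hb hb (hb.isOpen hW₁)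
    (by simpa using hw)
  obtain ⟨W₃, hW₃, V₂, hV₂, hwW₃, h1V₂, hWV₂⟩ := Continuous.exists_mem_basis_forall_mem
    (f := fun w v : G => w * v⁻¹) (y := w) (z := 1) (by fun_prop) hb hb (hb.isOpen hW₂)
    (by simpa using hwW₂)
  obtain ⟨V, hV, h1V, hVV⟩ := hb.exists_subset_of_mem_open (show 1 ∈ V₁ ∩ V₂ from ⟨h1V₁, h1V₂⟩)
    ((hb.isOpen hV₁).inter (hb.isOpen hV₂))
  have hAc := h.compl_mem A hA
  have hDmem := h.compl_mem _ (h.vaught_mem _ hAc _ hW₂)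
  have hxV : x ∈ vaught V (vaught W₂ Aᶜ)ᶜ :=
    mem_vaught_of_forall (hb.isOpen hV) ⟨1, h1V⟩ fun v hv hvx =>
      hxW₁ (mem_vaught_of_smul hvx fun w hw => hWV₁ w hw v (hVV hv).1)
  have hsub₁ : (vaught U A)ᶜ ⊆ vaught W₃ Aᶜ := by
    refine compl_subset_comm.1 fun z hz => vaught_mono (fun w hw => hW₁U ?_) subset_rfl
      (mem_vaught_of_notMem_compl (hb.isOpen hW₃) ⟨_, hwW₃⟩ hz)
    simpa using hWV₁ _ (hWV₂ w hw 1 h1V₂) 1 h1V₁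
  refine Filter.disjoint_iff.2 ⟨vaught W₃ Aᶜ, ?_, vaught V (vaught W₂ Aᶜ)ᶜ, ?_, ?_⟩
  · exact (@IsOpen.mem_nhdsSet X (vaughtTopology 𝓤 𝓑) _ _ (isOpen_vaughtTopology hW₃ hAc)).2 hsub₁
  · exact @IsOpen.mem_nhds X (vaughtTopology 𝓤 𝓑) _ _ (isOpen_vaughtTopology hV hDmem) hxV
  · refine disjoint_left.2 fun z hz hzV => ?_
    obtain ⟨v, hv, hvz⟩ := exists_smul_mem_of_mem_vaught hzV
    exact hvz (smul_mem_vaught hz fun w hw => hWV₂ w hw v (hVV hv).2)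

/-- The sets of pairs `(U, A)` with `x ∈ vaught U A`, for `x` in `X`, are described by implications
between open conditions. -/
theorem range_code [T2Space X] (h : IsVaughtFamily 𝓤 𝓑) {R : ℕ → 𝓤 × 𝓑 → 𝓤 × 𝓑 → Prop}
    (hR₁ : ∀ n i, ∀ y ∈ i.1.1, ∀ z ∈ i.2.1, ∃ j, R n i j ∧ y ∈ j.1.1 ∧ z ∈ j.2.1)
    (hR₂ : ∀ P : 𝓤 × 𝓑 → Prop, (∀ i, P i → i.1.1.Nonempty ∧ i.2.1.Nonempty) →
      (∀ n i, P i → ∃ j, R n i j ∧ P j) → ∀ i, P i → ∃ y ∈ i.1.1, ∃ z ∈ i.2.1,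
        ∀ k : 𝓤 × 𝓑, y ∈ k.1.1 → z ∈ k.2.1 → ∃ j, P j ∧ j.1.1 ⊆ k.1.1 ∧ j.2.1 ⊆ k.2.1) :
    ∃ D M Q : 𝓤 × 𝓑 → 𝓤 × 𝓑 → Prop,
      range (fun (x : X) (i : 𝓤 × 𝓑) => x ∈ vaught i.1.1 i.2.1) =
        {P | (∃ i, P i) ∧ (∀ i j, D i j → P i → ¬ P j) ∧
          (∀ n i, P i → ∃ j, R n i j ∧ P j) ∧ (∀ i j, M i j → P i → P j) ∧
          ∀ j, P j → ∃ i, Q i j ∧ P i} := by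
  have hb := h.isTopologicalBasis_left
  -- `Q i j` says that `i` codes an iterated transform contained in the transform coded by `j`.
  let Q : 𝓤 × 𝓑 → 𝓤 × 𝓑 → Prop := fun i j =>
    ∃ W ∈ 𝓤, (∀ w ∈ W, ∀ v ∈ i.1.1, w * v ∈ j.1.1) ∧ i.2.1 = vaught W j.2.1
  -- The first relation says that the boxes have disjoint images under `(u, a) ↦ u⁻¹ • a`, so no
  -- single point is coded by both. It holds of `i, i` when a factor is empty, which excludes such
  -- pairs.
  refine ⟨fun i j => ∀ u ∈ i.1.1, ∀ a ∈ i.2.1, ∀ v ∈ j.1.1, ∀ b ∈ j.2.1, u⁻¹ • a ≠ v⁻¹ • b,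
    fun i j => (i.1.1 ⊆ j.1.1 ∧ i.2.1 ⊆ j.2.1) ∨ Q i j, Q, subset_antisymm ?_ ?_⟩
  · rintro _ ⟨x, rfl⟩
    refine ⟨?_, fun i j hD hi hj => ?_, fun n i hi => ?_, ?_, fun j hj => ?_⟩
    · obtain ⟨A, hA, hxA, -⟩ :=
        h.isTopologicalBasis_isOpen.exists_subset_of_mem_open (mem_univ x) isOpen_univ
      obtain ⟨U, hU, h1U, hUA⟩ := hb.exists_subset_of_mem_open (a := (1 : G))
        (u := (· • x) ⁻¹' A) (by simpa using hxA) (hA.2.preimage (by fun_prop))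
      exact ⟨(⟨U, hU⟩, ⟨A, hA.1⟩), mem_vaught_of_forall (hb.isOpen hU) ⟨1, h1U⟩ hUA⟩
    · obtain ⟨u, hu, hux⟩ := exists_smul_mem_of_mem_vaught hi
      obtain ⟨v, hv, hvx⟩ := exists_smul_mem_of_mem_vaught hj
      exact hD u hu _ hux v hv _ hvx (by simp)
    · obtain ⟨W, hW, C, hC, ⟨_, _, hRij⟩, hx⟩ := exists_mem_vaught_of_cover h.countable_left
        h.countable_right (p := fun W C => ∃ (hW : W ∈ 𝓤) (hC : C ∈ 𝓑), R n i (⟨W, hW⟩, ⟨C, hC⟩))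
        hi fun g hg hgx => by
          obtain ⟨j, hj, hgj, hgxj⟩ := hR₁ n i g hg _ hgx
          exact ⟨_, j.1.2, _, j.2.2, hgj, hgxj, j.1.2, j.2.2, hj⟩
      exact ⟨_, hRij, hx⟩
    · rintro i j (⟨hU, hA⟩ | ⟨W, hW, hWU, hA⟩) hi
      · exact vaught_mono hU hA hi
      · refine vaught_vaught_subset hWU ?_
        rw [← hA]
        exact hi
    · obtain ⟨W, hW, V, hV, hWV, hx⟩ :=
        exists_mem_vaught_vaught hb h.countable_left (hb.isOpen j.1.2) hj
      exact ⟨(⟨V, hV⟩, ⟨_, h.vaught_mem _ j.2.2 W hW⟩), ⟨W, hW, hWV, rfl⟩, hx⟩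
  · rintro P ⟨⟨i₀, hi₀⟩, hD, hR, hM, hQ⟩
    have hne : ∀ i, P i → i.1.1.Nonempty ∧ i.2.1.Nonempty := fun i hi => by
      by_contra hne
      exact hD i i (fun u hu a ha => (hne ⟨⟨u, hu⟩, ⟨a, ha⟩⟩).elim) hi hi
    have hpt : ∀ i, P i → ∃ g ∈ i.1.1, ∃ y ∈ i.2.1,
        ∀ k : 𝓤 × 𝓑, g ∈ k.1.1 → y ∈ k.2.1 → P k := by
      intro i hi
      obtain ⟨g, hg, y, hy, hgy⟩ := hR₂ P hne hR i hi
      refine ⟨g, hg, y, hy, fun k hgk hyk => ?_⟩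
      obtain ⟨j, hj, hjk⟩ := hgy k hgk hyk
      exact hM j k (Or.inl hjk) hj
    obtain ⟨g, -, y, -, hgy⟩ := hpt i₀ hi₀
    obtain ⟨x, rfl⟩ : ∃ x, y = g • x := ⟨g⁻¹ • y, by simp⟩
    -- Limits obtained from different members of `P` decode to the same `x`: otherwise, by
    -- continuity for the original topology, small boxes around them would violate `hD`.
    have hpt' : ∀ i, P i → ∃ k ∈ i.1.1, k • x ∈ i.2.1 := by
      intro i hi
      obtain ⟨k, hk, z, hz, hkz⟩ := hpt i hi
      refine ⟨k, hk, ?_⟩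
      suffices k⁻¹ • z = x by rwa [← this, smul_inv_smul]
      by_contra hne
      obtain ⟨O₁, O₂, hO₁, hO₂, hz₁, hx₂, hdisj⟩ := t2_separation hne
      obtain ⟨U₁, hU₁, A₁, hA₁, hkU₁, hzA₁, h₁⟩ := Continuous.exists_mem_basis_forall_mem
        (f := fun (g : G) (x : X) => g⁻¹ • x) (by fun_prop) hb h.isTopologicalBasis_isOpen hO₁ hz₁
      obtain ⟨U₂, hU₂, A₂, hA₂, hgU₂, hxA₂, h₂⟩ := Continuous.exists_mem_basis_forall_mem
        (f := fun (g : G) (x : X) => g⁻¹ • x) (y := g) (z := g • x) (by fun_prop) hb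
        h.isTopologicalBasis_isOpen hO₂ (by simpa using hx₂)
      exact hD (⟨U₁, hU₁⟩, ⟨A₁, hA₁.1⟩) (⟨U₂, hU₂⟩, ⟨A₂, hA₂.1⟩)
        (fun u hu a ha v hv b hb => hdisj.ne_of_mem (h₁ u hu a ha) (h₂ v hv b hb))
        (hkz _ hkU₁ hzA₁) (hgy _ hgU₂ hxA₂)
    refine ⟨x, funext fun j => propext ⟨fun hj => ?_, fun hj => ?_⟩⟩
    -- Membership of `x` is moved to `g • x`: the pair `(V', vaught W A)` is a box around `(g, g •
    -- x)`, hence in `P`, and monotonicity along `Q` carries it to `j`.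
    · rw [← inv_smul_smul g x] at hj
      obtain ⟨W, hW, V, hV, hgV, hWV, hx⟩ :=
        exists_mem_vaught_of_smul hb h.countable_left (hb.isOpen j.1.2) hj
      obtain ⟨V', hV', hgV', hVV'⟩ := hb.exists_subset_of_mem_open (a := g) (u := V⁻¹) hgV
        (hb.isOpen hV).inv
      refine hM (⟨V', hV'⟩, ⟨_, h.vaught_mem _ j.2.2 W hW⟩) j
        (Or.inr ⟨W, hW, fun w hw v hv => ?_, rfl⟩) (hgy _ hgV' hx)
      simpa using hWV w hw v⁻¹ (hVV' hv)
    · obtain ⟨i, ⟨W, hW, hWU, hA⟩, hi⟩ := hQ j hj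
      obtain ⟨k, hk, hkx⟩ := hpt' i hi
      rw [hA] at hkx
      exact mem_vaught_of_smul hkx fun w hw => hWU w hw k hk

/-- The topology generated by Vaught transforms is Polish if the family of sets is a basis of some
Polish topology. -/
theorem polishSpace_vaughtTopology [PolishSpace G] [T2Space X] [BorelSpace X]
    (h : IsVaughtFamily 𝓤 𝓑)
    (hσ : ∃ σ : TopologicalSpace X, @PolishSpace X σ ∧ @IsTopologicalBasis X σ 𝓑) :
    @PolishSpace X (vaughtTopology 𝓤 𝓑) := by
  have := h.countable_left.to_subtype
  have := h.countable_right.to_subtype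
  have hT2 : @T2Space X (vaughtTopology 𝓤 𝓑) := t2Space_antitone h.vaughtTopology_le ‹_›
  have hreg := h.regularSpace
  have hT3 : @T3Space X (vaughtTopology 𝓤 𝓑) :=
    @T3Space.mk X (vaughtTopology 𝓤 𝓑) inferInstance hreg
  have hsc : @SecondCountableTopology X (vaughtTopology 𝓤 𝓑) :=
    @SecondCountableTopology.mk X (vaughtTopology 𝓤 𝓑) ⟨_, countable_range _, rfl⟩
  have hcode := fun R => h.range_code (R := R)
  have hb := h.isTopologicalBasis_left
  obtain ⟨σ, hσP, hσb⟩ := hσ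
  obtain ⟨R, hR₁, hR₂⟩ := @exists_refinement_prod G X _ _ σ hσP _ _ hb hσb
  obtain ⟨D, M, Q, hrange⟩ := hcode R hR₁ hR₂
  refine @PolishSpace.of_isInducing_prop X _ (vaughtTopology 𝓤 𝓑) hT3 hsc _
    (isInducing_mem_generateFrom _) fun Z _ _ f hf => ?_
  rw [hrange]
  exact isGδ_setOf_code hf D M Q R

end IsVaughtFamily

/-! ### Existence of a suitable family and the conclusion. -/

theorem exists_isVaughtFamily (G : Type*) {X : Type*} [Group G] [TopologicalSpace G]
    [IsTopologicalGroup G] [PolishSpace G] [TopologicalSpace X] [PolishSpace X] [MeasurableSpace X]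
    [BorelSpace X] [MulAction G X] [ContinuousSMul G X] {B : Set X} (hB : MeasurableSet B) :
    ∃ (𝓤 : Set (Set G)) (𝓑 : Set (Set X)), IsVaughtFamily 𝓤 𝓑 ∧ B ∈ 𝓑 ∧
      ∃ σ : TopologicalSpace X, @PolishSpace X σ ∧ @IsTopologicalBasis X σ 𝓑 := by
  obtain ⟨𝓑, hsub, hc, hm, hΦ, hσ⟩ := exists_countable_isTopologicalBasis
    (fun A => insert Aᶜ ((fun U : Set G => vaught U A) '' countableBasis G))
    (fun A => ((countable_countableBasis G).image _).insert _)
    (by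
      rintro A hA _ (rfl | ⟨U, hU, rfl⟩)
      exacts [hA.compl, hA.vaught (isOpen_of_mem_countableBasis hU)])
    ((countable_countableBasis X).insert B)
    (by
      rintro A (rfl | hA)
      exacts [hB, (isOpen_of_mem_countableBasis hA).measurableSet])
  refine ⟨countableBasis G, 𝓑, ⟨isBasis_countableBasis G, countable_countableBasis G,
    fun U hU => nonempty_of_mem_countableBasis hU, ?_, hc, hm,
    fun A hA => hΦ A hA (mem_insert _ _),
    fun A hA U hU => hΦ A hA (mem_insert_of_mem _ (mem_image_of_mem _ hU))⟩,
    hsub (mem_insert _ _), hσ⟩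
  refine isTopologicalBasis_of_isOpen_of_nhds (fun A hA => hA.2) fun x O hx hO => ?_
  obtain ⟨A, hA, hxA, hAO⟩ := (isBasis_countableBasis X).exists_subset_of_mem_open hx hO
  exact ⟨A, ⟨hsub (mem_insert_of_mem _ hA), isOpen_of_mem_countableBasis hA⟩, hxA, hAO⟩

/-- `t' ≤ t` in the order on topologies says that `t'` is finer than `t`. -/
theorem theorem1p2 {G X : Type*}
    [Group G] [TopologicalSpace G] [IsTopologicalGroup G] [PolishSpace G]
    [t : TopologicalSpace X] [PolishSpace X] [MulAction G X] [ContinuousSMul G X]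
    (B : Set X) (hB : @MeasurableSet X (borel X) B)
    (hinv : ∀ g : G, ∀ x ∈ B, g • x ∈ B) :
    ∃ t' : TopologicalSpace X,
      t' ≤ t ∧
      @PolishSpace X t' ∧
      @borel X t' = @borel X t ∧
      @IsClopen X t' B ∧
      @Continuous (G × X) X (@instTopologicalSpaceProd G X _ t') t' (fun p => p.1 • p.2) := by
  borelize X
  obtain ⟨𝓤, 𝓑, h, hBmem, hσ⟩ := exists_isVaughtFamily G hB
  have hP := h.polishSpace_vaughtTopology hσ
  exact ⟨vaughtTopology 𝓤 𝓑, h.vaughtTopology_le, hP,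
    MeasureTheory.borel_eq_borel_of_le hP ‹_› h.vaughtTopology_le,
    h.isClopen_of_invariant hBmem hinv, h.continuous_smul⟩
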